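/- Let $M$ be a compact connected (smooth, boundaryless) Riemannian manifold with Riemannian distance $d$, let $(X,\mathbb P)$ be a probability space, $\theta:X\to X$ an invertible bimeasurable $\mathbb P$-preserving ergodic map, and for $w\in X$ let $f_w:M\to M$ be local homeomorphisms with $(w,x)\mapsto f_w(x)$ measurable. Put $f_w^0=\mathrm{id}$, $f_w^n=f_{\theta^{n-1}w}\circ\dots\circ f_w$, $F(w,x)=(\theta w,f_w(x))$, $B(x,\varepsilon)=\{y\in M: d(x,y)<\varepsilon\}$. Assume that there are continuous functions $L_w:M\to\mathbb R$ such that every $x\in M$ has a neighbourhood $U_x$ on which $f_w$ is injective with $d(f_w^{-1}(y),f_w^{-1}(z))\le L_w(x)\,d(y,z)$ for all $y,z\in f_w(U_x)$, where $f_w^{-1}$ denotes the inverse of $f_w|_{U_x}$, and that $\sup_w\deg f_w<\infty$, where $\deg f_w=\#f_w^{-1}(x)$ (which does not depend on $x$). Assume moreover that there are open sets $\mathcal A_w\subset M$, constants $\sigma_w>1$, $L_w>1$ and integers $q_w\ge 0$ such that: (I) $L_w(x)\le L_w$ for $x\in\mathcal A_w$, and $L_w(x)<\sigma_w^{-1}$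 for $x\notin\mathcal A_w$; (II) $M$ has a finite covering by open domains of injectivity of $f_w$, of which $q_w<\deg f_w$ cover $\mathcal A_w$; (III) for all $w\in X$ and $\varepsilon>0$ there is $\tilde n\ge1$ with $f_{\theta^jw}^{\tilde n}(B(f_w^j(x),\varepsilon))=M$ for all $j\ge0$ and $x\in M$; (IV) there is $\varepsilon_0>0$ with $e^{\varepsilon_0}q_w<\deg f_w$ for all $w$; (V) there are $c_0>0$ and $\rho\in(0,1)$ such that for $\mathbb P$-a.e. $w$ there are $\hat L_w$ and $\hat\sigma_w>1$ with $L_{\theta^jw}\le\hat L_w$, $\hat\sigma_w\le\sigma_{\theta^jw}$ for all $j\ge0$, and $\hat L_w^{\rho}\hat\sigma_w^{-(1-\rho)}<e^{-2c_0}$; (H1) $\log^+L_w(x)$ and $\log^+(L_w(x)^{-1})$ are integrable with respect to every $F$-invariant probability measure on $X\times M$ with marginal $\mathbb P$ on $X$; (H2) $\inf_{(w,x)}L_w(x)>0$; (H3) for every $\varepsilon>0$ there is $\delta>0$ such that for $\mathbb P$-a.e. $w$, $L_w(x)/L_w(z)\le e^{\varepsilon/2}$ whenever $d(x,z)<\delta$.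 Let $\mu$ be an $F$-invariant probability measure on $X\times M$ with marginal $\mathbb P$ that is expanding: there is $c>0$ with $\limsup_{n\to\infty}\frac1n\sum_{j=0}^{n-1}\log L_{\theta^jw}(f_w^j(x))\le-2c$ for $\mu$-a.e. $(w,x)$. Then $(F,\mu)$ has the nonuniform specification property between fibres: there are integers $K(n,(w,x),\varepsilon)\ge0$ such that for $\mu$-a.e. $(w,x)$ and every $\varepsilon>0$, for each $n\ge1$ the dynamical ball $B_{n,w}(x,\varepsilon)=\{y\in M: d(f_w^k(y),f_w^k(x))<\varepsilon,\ 0\le k\le n\}$ contains a point $p$ with $f_w^{n+K(n,(w,x),\varepsilon)}(p)=p$, and $\limsup_{n\to\infty}K(n,(w,x),\varepsilon)/n=0$. -/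

import Mathlib

open MeasureTheory Filter Topology Set Bundle
open scoped Manifold ContDiff

noncomputable section

namespace RandomSpec

variable {X M : Type*}

/-- The fibre iterates `f_w^n = f_{θ^{n-1} w} ∘ ⋯ ∘ f_{θ w} ∘ f_w`, with `f_w^0 = id`. -/
def fiberIterate (θ : X → X) (f : X → M → M) : ℕ → X → M → M
  | 0, _ => id
  | n + 1, w => f (θ^[n] w) ∘ fiberIterate θ f n w

/-- The skew product `F (w, x) = (θ w, f_w x)`. -/
def skewProduct (θ : X → X) (f : X → M → M) (z : X × M) : X × M := (θ z.1, f z.1 z.2)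

/-- The dynamical ball `B_{n,w}(x, ε)`, the points that stay `ε`-close to `x` in the fibres for the
times `0, …, n`. -/
def dynamicalBall [MetricSpace M] (θ : X → X) (f : X → M → M) (n : ℕ) (w : X) (x : M) (ε : ℝ) :
    Set M :=
  ⋂ k ∈ Finset.range (n + 1),
    fiberIterate θ f k w ⁻¹' Metric.ball (fiberIterate θ f k w x) ε

/-- `p` returns at the time `m ≥ 1` in the fibre dynamics that starts at `w`. -/
def ReturnsAt (θ : X → X) (f : X → M → M) (w : X) (p : M) (m : ℕ) : Prop :=
  1 ≤ m ∧ fiberIterate θ f m w p = p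

/-- The `F`-invariant probability measures on `X × M` with marginal `P` on the base. -/
structure IsInvariantOver [MeasurableSpace X] [MeasurableSpace M] (P : Measure X)
    (θ : X → X) (f : X → M → M) (μ : Measure (X × M)) : Prop where
  isProbabilityMeasure : IsProbabilityMeasure μ
  marginal : μ.map Prod.fst = P
  invariant : MeasurePreserving (skewProduct θ f) μ μ

/-- The number of preimages of `x`. For a local homeomorphism of a compact connected manifold it is
finite and does not depend on `x`: it is the degree. -/
def preimageCount (g : M → M) (x : M) : ℕ := (g ⁻¹' {x}).ncard

/-- The standing setting: an invertible ergodic base, a measurable family of local homeomorphisms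
of bounded degree, and continuous functions `L_w` such that the local inverse of `f_w` near `x` is
Lipschitz with constant `L_w x`. -/
structure IsRandomSystem [MeasurableSpace X] [MetricSpace M] [MeasurableSpace M]
    (P : Measure X) (θ : X ≃ᵐ X) (f : X → M → M) (L : X → M → ℝ) : Prop where
  ergodic_base : Ergodic θ P
  measurable_family : Measurable fun z : X × M => f z.1 z.2
  isLocalHomeomorph : ∀ w, IsLocalHomeomorph (f w)
  continuous_lip : ∀ w, Continuous (L w)
  local_inverse_lip : ∀ w x, ∃ U ∈ 𝓝 x, InjOn (f w) U ∧
    ∀ a ∈ U, ∀ b ∈ U, dist a b ≤ L w x * dist (f w a) (f w b)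
  bounded_degree : ∃ D : ℕ, ∀ w x, (f w ⁻¹' {x}).encard ≤ D

/-- The five conditions on the generating maps: `A w` is the region where contraction may be
absent, `Lsup w` bounds `L_w` on it, `σ w` is the expansion rate outside it, and `q w` is the
number of injectivity domains needed to cover it. -/
structure GeneratingConditions [MeasurableSpace X] [MetricSpace M]
    (P : Measure X) (θ : X → X) (f : X → M → M) (L : X → M → ℝ)
    (A : X → Set M) (Lsup σ : X → ℝ) (q : X → ℕ) : Prop where
  isOpen_region : ∀ w, IsOpen (A w)
  one_lt_Lsup : ∀ w, 1 < Lsup w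
  one_lt_rate : ∀ w, 1 < σ w
  lip_on_region : ∀ w, ∀ x ∈ A w, L w x ≤ Lsup w
  lip_off_region : ∀ w, ∀ x ∉ A w, L w x < (σ w)⁻¹
  injectivity_cover : ∀ w, ∃ 𝒰 : Set (Set M), 𝒰.Finite ∧
    (∀ U ∈ 𝒰, IsOpen U ∧ InjOn (f w) U) ∧ ⋃₀ 𝒰 = univ ∧
    ∃ 𝒱 ⊆ 𝒰, 𝒱.ncard = q w ∧ A w ⊆ ⋃₀ 𝒱
  cover_lt_degree : ∀ w x, q w < preimageCount (f w) x
  topologically_exact : ∀ w, ∀ ε : ℝ, 0 < ε → ∃ N : ℕ, 1 ≤ N ∧ ∀ (j : ℕ) (x : M),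
    fiberIterate θ f N (θ^[j] w) '' Metric.ball (fiberIterate θ f j w x) ε = univ
  degree_gap : ∃ ε₀ : ℝ, 0 < ε₀ ∧ ∀ w x,
    Real.exp ε₀ * (q w : ℝ) < (preimageCount (f w) x : ℝ)
  uniform_along_orbits : ∃ c : ℝ, 0 < c ∧ ∃ ρ : ℝ, 0 < ρ ∧ ρ < 1 ∧
    ∀ᵐ w ∂P, ∃ Lhat σhat : ℝ, 1 < σhat ∧
      (∀ j : ℕ, Lsup (θ^[j] w) ≤ Lhat ∧ σhat ≤ σ (θ^[j] w)) ∧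
      Lhat ^ ρ * σhat ^ (-(1 - ρ)) < Real.exp (-2 * c)

/-- The three regularity conditions: integrability of `log⁺ L` and `log⁺ (1 / L)` for all invariant
measures over `P`, a uniform positive lower bound, and uniform control of the oscillation. -/
structure RegularityConditions [MeasurableSpace X] [MetricSpace M] [MeasurableSpace M]
    (P : Measure X) (θ : X → X) (f : X → M → M) (L : X → M → ℝ) : Prop where
  integrable_log : ∀ ν : Measure (X × M), IsInvariantOver P θ f ν →
    Integrable (fun z : X × M => Real.posLog (L z.1 z.2)) ν ∧
    Integrable (fun z : X × M => Real.posLog (L z.1 z.2)⁻¹) ν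
  lower_bound : ∃ m : ℝ, 0 < m ∧ ∀ w x, m ≤ L w x
  distortion : ∀ ε : ℝ, 0 < ε → ∃ δ : ℝ, 0 < δ ∧ ∀ᵐ w ∂P, ∀ x, ∀ z ∈ Metric.ball x δ,
    L w x / L w z ≤ Real.exp (ε / 2)

/-- The measure `μ` is expanding: for some `c > 0`, almost everywhere
`limsup (1/n) ∑_{j<n} log L_{θ^j w} (f_w^j x) ≤ -2c`. -/
def IsExpanding [MeasurableSpace X] [MeasurableSpace M]
    (θ : X → X) (f : X → M → M) (L : X → M → ℝ) (μ : Measure (X × M)) : Prop :=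
  ∃ c : ℝ, 0 < c ∧ ∀ᵐ z ∂μ,
    limsup (fun n : ℕ => (((1 / (n : ℝ)) *
      ∑ j ∈ Finset.range n, Real.log (L (θ^[j] z.1) (fiberIterate θ f j z.1 z.2)) : ℝ) : EReal))
      atTop ≤ ((-2 * c : ℝ) : EReal)

/-- The nonuniform specification property between fibres. -/
def NonuniformSpecification [MeasurableSpace X] [MetricSpace M] [MeasurableSpace M]
    (θ : X → X) (f : X → M → M) (μ : Measure (X × M)) : Prop :=
  ∃ K : ℕ → X × M → ℝ → ℕ, ∀ᵐ z ∂μ, ∀ ε : ℝ, 0 < ε →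
    (∀ n : ℕ, 1 ≤ n →
      ∃ p ∈ dynamicalBall θ f n z.1 z.2 ε, ReturnsAt θ f z.1 p (n + K n z ε)) ∧
    limsup (fun n : ℕ => (((K n z ε : ℝ) / (n : ℝ) : ℝ) : EReal)) atTop = 0

end RandomSpec

end

/-! Let `S m` be the sum of `log L + c` over the first `m` points of the orbit of `x`. If `S m ≤ S
k` for all `k ≤ m`, the product of `exp (c / 2) * L` over the times from `k` to `m` is at most `exp
(-(c / 2) * (m - k))`. The factor `exp (c / 2)` pays for the oscillation of `L` on small balls, so
the inverse branch of `f_w^m` along the orbit lives on a ball of fixed radius `r₁` about `f_w^m x`,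
its image shadows the orbit of `x`, and it contracts by `exp (-(c / 2) * m)`
(`exists_inverse_branch`). Exactness gives a fixed `N` and a point `y` close to `f_w^m x` which the
next `N` steps carry to `x`. The branch back from `x` to `y` is Lipschitz with a constant
independent of `m`, so for large `m` the composition of both branches contracts a closed ball about
`x`. Its fixed point returns at time `m + N` (`exists_periodic_of_inverse_branches`). By Birkhoff's
theorem `S m / m` converges, to a negative limit, which makes such minimal times `τ n ≥ n` satisfy
`τ n / n → 1` (`exists_tendsto_of_isMinimal_times`). Thus `K n = τ n + N - n` is sublinear. -/

namespace MeasureTheory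

/-! ### Birkhoff's pointwise ergodic theorem -/

variable {α : Type*} {T : α → α} {φ : α → ℝ}

/-- The running maximum of the Birkhoff sums `0, S₁ φ, …, Sₙ φ`, defined recursively. -/
def birkhoffMax (T : α → α) (φ : α → ℝ) : ℕ → α → ℝ
  | 0, _ => 0
  | n + 1, x => max 0 (φ x + birkhoffMax T φ n (T x))

theorem birkhoffMax_nonneg (n : ℕ) (x : α) : 0 ≤ birkhoffMax T φ n x := by
  cases n <;> simp [birkhoffMax]

theorem birkhoffMax_le_succ (n : ℕ) (x : α) :
    birkhoffMax T φ n x ≤ birkhoffMax T φ (n + 1) x := by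
  induction n generalizing x with
  | zero => simp [birkhoffMax]
  | succ n ih => exact max_le_max le_rfl (by have := ih (T x); simp only [birkhoffMax] at *; linarith)

theorem birkhoffSum_le_birkhoffMax (n : ℕ) (x : α) :
    birkhoffSum T φ n x ≤ birkhoffMax T φ n x := by
  induction n generalizing x with
  | zero => simp [birkhoffMax]
  | succ n ih =>
    rw [birkhoffSum_succ']
    exact (add_le_add le_rfl (ih (T x))).trans (le_max_right _ _)

/-- The points where the upper limit of the Birkhoff averages is larger than `b`. -/
def upperBirkhoffSet (T : α → α) (φ : α → ℝ) (b : ℝ) : Set α :=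
  {x | ∃ r : ℚ, b < r ∧ ∃ᶠ n : ℕ in atTop, (r : ℝ) * n < birkhoffSum T φ n x}

/-- Passing between `x` and `T x` shifts the time by one and changes the sum by `φ x`. The strict
inequality `b < r` leaves room for a smaller rational `s` that absorbs this bounded change. -/
theorem preimage_upperBirkhoffSet (b : ℝ) :
    T ⁻¹' upperBirkhoffSet T φ b = upperBirkhoffSet T φ b := by
  ext x
  constructor
  · rintro ⟨r, hr, h⟩
    obtain ⟨s, hs, hsr⟩ := exists_rat_btwn hr
    refine ⟨s, hs, ?_⟩
    have hlarge : ∀ᶠ n : ℕ in atTop, s - φ x < (r - s : ℝ) * n :=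
      (tendsto_natCast_atTop_atTop.const_mul_atTop (sub_pos.2 hsr)).eventually_gt_atTop _
    refine (tendsto_add_atTop_nat 1).frequently ((h.and_eventually hlarge).mono ?_)
    rintro n ⟨h1, h2⟩
    rw [birkhoffSum_succ']
    push_cast
    linarith
  · rintro ⟨r, hr, h⟩
    obtain ⟨s, hs, hsr⟩ := exists_rat_btwn hr
    refine ⟨s, hs, ?_⟩
    have hlarge : ∀ᶠ n : ℕ in atTop, φ x - s < (r - s : ℝ) * n :=
      (tendsto_natCast_atTop_atTop.const_mul_atTop (sub_pos.2 hsr)).eventually_gt_atTop _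
    have h' : ∃ᶠ n : ℕ in map (fun k => k - 1) atTop, (s : ℝ) * n < birkhoffSum T φ n (T x) := by
      refine ((h.and_eventually hlarge).and_eventually (eventually_ge_atTop 1)).mono ?_
      rintro n ⟨⟨h1, h2⟩, h3⟩
      obtain ⟨k, rfl⟩ : ∃ k, n = k + 1 := ⟨n - 1, by omega⟩
      rw [birkhoffSum_succ'] at h1
      simp only [add_tsub_cancel_right]
      push_cast at h1 h2
      linarith
    exact h'.filter_mono (tendsto_sub_atTop_nat 1)

theorem birkhoffSum_sub_const (b : ℝ) (n : ℕ) (x : α) :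
    birkhoffSum T (fun y => φ y - b) n x = birkhoffSum T φ n x - b * n := by
  simp [birkhoffSum, Finset.sum_sub_distrib, mul_comm]

variable [MeasurableSpace α] {μ : Measure α}

theorem measurable_birkhoffMax (hT : Measurable T) (hφ : Measurable φ) (n : ℕ) :
    Measurable (birkhoffMax T φ n) := by
  induction n with
  | zero => exact measurable_const
  | succ n ih => exact measurable_const.max (hφ.add (ih.comp hT))

theorem integrable_birkhoffMax (hT : MeasurePreserving T μ μ) (hφ : Integrable φ μ) (n : ℕ) :
    Integrable (birkhoffMax T φ n) μ := by
  induction n with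
  | zero => exact integrable_zero _ _ _
  | succ n ih =>
    exact (integrable_zero _ _ _).sup (hφ.add (hT.integrable_comp_of_integrable ih))

/-- The maximal ergodic theorem, for a function whose Birkhoff sums are almost everywhere positive
at some time. -/
theorem integral_nonneg_of_ae_exists_birkhoffSum_pos (hT : MeasurePreserving T μ μ)
    (hm : Measurable φ) (hφ : Integrable φ μ) (hpos : ∀ᵐ x ∂μ, ∃ n, 0 < birkhoffSum T φ n x) :
    0 ≤ ∫ x, φ x ∂μ := by
  set E : ℕ → Set α := fun n => {x | 0 < birkhoffMax T φ n x}
  have hE (n) : MeasurableSet (E n) :=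
    measurableSet_lt measurable_const (measurable_birkhoffMax hT.measurable hm n)
  have hmono : Monotone E := monotone_nat_of_le_succ fun n x hx =>
    lt_of_lt_of_le hx (birkhoffMax_le_succ n x)
  have hlim := tendsto_setIntegral_of_monotone (μ := μ) (f := φ) hE hmono hφ.integrableOn
  have hunion : ∫ x in ⋃ n, E n, φ x ∂μ = ∫ x, φ x ∂μ := by
    rw [Measure.restrict_eq_self_of_ae_mem]
    filter_upwards [hpos] with x hx
    obtain ⟨n, hn⟩ := hx
    exact mem_iUnion.2 ⟨n, hn.trans_le (birkhoffSum_le_birkhoffMax n x)⟩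
  rw [hunion] at hlim
  refine ge_of_tendsto hlim (Eventually.of_forall fun n => ?_)
  have hR := integrable_birkhoffMax hT hφ n
  have hRT := hT.integrable_comp_of_integrable hR
  have hinv : ∫ x, (birkhoffMax T φ n x - birkhoffMax T φ n (T x)) ∂μ = 0 := by
    rw [integral_sub hR (by exact hRT), sub_eq_zero]
    have := integral_map (μ := μ) hT.measurable.aemeasurable
      (f := birkhoffMax T φ n) (by rw [hT.map_eq]; exact hR.aestronglyMeasurable)
    rwa [hT.map_eq] at this
  -- Pointwise, `M_n - M_n ∘ T` is at most `φ` where `M_n > 0`, because there `M_n = φ + M_{n-1} ∘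
  -- T`, and at most `0` elsewhere. Its integral vanishes by invariance.
  rw [← integral_indicator (hE n), ← hinv]
  refine integral_mono (hR.sub hRT) (hφ.indicator (hE n)) fun x => ?_
  have h0 := birkhoffMax_nonneg (T := T) (φ := φ) n (T x)
  by_cases hx : x ∈ E n
  · rw [indicator_of_mem hx]
    have hx' : 0 < birkhoffMax T φ n x := hx
    cases n with
    | zero => simp [birkhoffMax] at hx'
    | succ n =>
      have h1 := birkhoffMax_le_succ (T := T) (φ := φ) n (T x)
      have h2 : birkhoffMax T φ (n + 1) x = φ x + birkhoffMax T φ n (T x) := by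
        simp only [birkhoffMax] at hx' ⊢
        rcases max_choice 0 (φ x + birkhoffMax T φ n (T x)) with h | h
        · rw [h] at hx'; exact absurd hx' (lt_irrefl _)
        · exact h
      linarith
  · rw [indicator_of_notMem hx]
    have hx' : birkhoffMax T φ n x ≤ 0 := not_lt.1 hx
    linarith

theorem measurableSet_upperBirkhoffSet (hT : Measurable T) (hφ : Measurable φ) (b : ℝ) :
    MeasurableSet (upperBirkhoffSet T φ b) := by
  have hS (n : ℕ) : Measurable (birkhoffSum T φ n) :=
    Finset.measurable_sum _ fun k _ => hφ.comp (hT.iterate k)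
  have : upperBirkhoffSet T φ b = ⋃ r : ℚ, ⋃ _ : b < r, ⋂ N : ℕ, ⋃ n : ℕ, ⋃ _ : N ≤ n,
      {x | (r : ℝ) * n < birkhoffSum T φ n x} := by
    ext x
    simp [upperBirkhoffSet, frequently_atTop]
  rw [this]
  exact .iUnion fun r => .iUnion fun _ => .iInter fun N => .iUnion fun n => .iUnion fun _ =>
    measurableSet_lt measurable_const (hS n)

/-- This is the maximal ergodic theorem for `φ - b` and the restriction of `μ` to the invariant set
`E`. -/
theorem mul_measureReal_le_setIntegral_of_subset_upperBirkhoffSet [IsFiniteMeasure μ]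
    (hT : MeasurePreserving T μ μ) (hm : Measurable φ) (hφ : Integrable φ μ) {b : ℝ} {E : Set α}
    (hE : MeasurableSet E) (hinv : T ⁻¹' E = E) (hsub : E ⊆ upperBirkhoffSet T φ b) :
    b * μ.real E ≤ ∫ x in E, φ x ∂μ := by
  have hTE : MeasurePreserving T (μ.restrict E) (μ.restrict E) := by
    simpa only [hinv] using hT.restrict_preimage hE
  have key := integral_nonneg_of_ae_exists_birkhoffSum_pos hTE (hm.sub_const b)
    (hφ.integrableOn.sub (integrable_const b)) (by
      filter_upwards [ae_restrict_mem hE] with x hx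
      obtain ⟨r, hr, h⟩ := hsub hx
      obtain ⟨n, hn⟩ := h.exists
      refine ⟨n, ?_⟩
      rw [birkhoffSum_sub_const]
      have : b * n ≤ r * n := by gcongr
      linarith)
  rw [integral_sub hφ.integrableOn (integrable_const b)] at key
  simp at key
  linarith [mul_comm b (μ.real E)]

theorem ae_bddAbove_birkhoffSum_div [IsFiniteMeasure μ] (hT : MeasurePreserving T μ μ)
    (hm : Measurable φ) (hφ : Integrable φ μ) :
    ∀ᵐ x ∂μ, ∃ b : ℕ, x ∉ upperBirkhoffSet T φ b := by
  set W : Set α := ⋂ b : ℕ, upperBirkhoffSet T φ b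
  have hW : MeasurableSet W := .iInter fun b =>
    measurableSet_upperBirkhoffSet hT.measurable hm _
  have hinv : T ⁻¹' W = W := by
    simp only [W, preimage_iInter, preimage_upperBirkhoffSet]
  have hle (b : ℕ) : b * μ.real W ≤ ∫ x in W, φ x ∂μ :=
    mul_measureReal_le_setIntegral_of_subset_upperBirkhoffSet hT hm hφ hW hinv
      (iInter_subset _ b)
  have hzero : μ W = 0 := by
    rw [← measureReal_eq_zero_iff]
    by_contra hne
    have hpos : 0 < μ.real W := lt_of_le_of_ne measureReal_nonneg (Ne.symm hne)
    obtain ⟨b, hb⟩ := exists_nat_gt ((∫ x in W, φ x ∂μ) / μ.real W)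
    rw [div_lt_iff₀ hpos] at hb
    linarith [hle b]
  have : ∀ᵐ x ∂μ, x ∉ W := measure_eq_zero_iff_ae_notMem.1 hzero
  filter_upwards [this] with x hx
  simpa [W] using hx

/-- **Birkhoff's pointwise ergodic theorem**, existence of the limit, for a measurable function. -/
theorem ae_exists_tendsto_birkhoffSum_div_of_measurable [IsFiniteMeasure μ]
    (hT : MeasurePreserving T μ μ) (hm : Measurable φ) (hφ : Integrable φ μ) :
    ∀ᵐ x ∂μ, ∃ l, Tendsto (fun n : ℕ => birkhoffSum T φ n x / n) atTop (𝓝 l) := by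
  -- On the invariant set `E` of points whose averages oscillate across `[a, b]`, the previous bound
  -- for `φ` and `-φ` gives `b * μ E ≤ ∫_E φ ≤ a * μ E`, hence `μ E = 0`.
  have hcross : ∀ᵐ x ∂μ, ∀ a b : ℚ, a < b →
      ¬ (x ∈ upperBirkhoffSet T φ b ∧ x ∈ upperBirkhoffSet T (-φ) (-(a : ℝ))) := by
    refine ae_all_iff.2 fun a => ae_all_iff.2 fun b => ?_
    by_cases hab : a < b
    swap
    · exact Eventually.of_forall fun x h => absurd h hab
    set E := upperBirkhoffSet T φ b ∩ upperBirkhoffSet T (-φ) (-(a : ℝ))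
    have hE : MeasurableSet E := (measurableSet_upperBirkhoffSet hT.measurable hm _).inter
      (measurableSet_upperBirkhoffSet hT.measurable hm.neg _)
    have hinv : T ⁻¹' E = E := by
      simp only [E, preimage_inter, preimage_upperBirkhoffSet]
    have h1 := mul_measureReal_le_setIntegral_of_subset_upperBirkhoffSet hT hm hφ hE hinv
      inter_subset_left
    have h2 := mul_measureReal_le_setIntegral_of_subset_upperBirkhoffSet hT hm.neg hφ.neg hE hinv
      inter_subset_right
    simp only [Pi.neg_apply, integral_neg] at h2
    have hab' : (a : ℝ) < b := by exact_mod_cast hab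
    have hzero : μ E = 0 := by
      rw [← measureReal_eq_zero_iff]
      have := measureReal_nonneg (μ := μ) (s := E)
      nlinarith
    filter_upwards [measure_eq_zero_iff_ae_notMem.1 hzero] with x hx _
    exact hx
  filter_upwards [hcross, ae_bddAbove_birkhoffSum_div hT hm hφ,
    ae_bddAbove_birkhoffSum_div hT hm.neg hφ.neg] with x hx hup hlow
  have hupper {b : ℝ} (hx : x ∉ upperBirkhoffSet T φ b) {r : ℚ} (hr : b < r) :
      ∀ᶠ n : ℕ in atTop, birkhoffSum T φ n x / n ≤ r := by
    have : ¬ ∃ᶠ n : ℕ in atTop, (r : ℝ) * n < birkhoffSum T φ n x := fun h => hx ⟨r, hr, h⟩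
    filter_upwards [not_frequently.1 this, eventually_gt_atTop 0] with n hn hn0
    rw [div_le_iff₀ (by exact_mod_cast hn0)]
    exact not_lt.1 hn
  have hlower {b : ℝ} (hx : x ∉ upperBirkhoffSet T (-φ) b) {r : ℚ} (hr : b < r) :
      ∀ᶠ n : ℕ in atTop, -(r : ℝ) ≤ birkhoffSum T φ n x / n := by
    have : ¬ ∃ᶠ n : ℕ in atTop, (r : ℝ) * n < birkhoffSum T (-φ) n x := fun h => hx ⟨r, hr, h⟩
    filter_upwards [not_frequently.1 this, eventually_gt_atTop 0] with n hn hn0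
    rw [le_div_iff₀ (by exact_mod_cast hn0)]
    have := not_lt.1 hn
    rw [birkhoffSum_neg] at this
    linarith
  obtain ⟨b, hb⟩ := hup
  obtain ⟨a, ha⟩ := hlow
  have hbt : ((b : ℕ) : ℝ) < ((b + 1 : ℚ) : ℝ) := by push_cast; linarith
  have hat : ((a : ℕ) : ℝ) < ((a + 1 : ℚ) : ℝ) := by push_cast; linarith
  refine tendsto_of_no_upcrossings Rat.denseRange_cast ?_
    ⟨_, eventually_map.2 (hupper hb hbt)⟩ ⟨_, eventually_map.2 (hlower ha hat)⟩
  rintro _ ⟨p, rfl⟩ _ ⟨s, rfl⟩ hps ⟨h1, h2⟩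
  -- Staying outside `upperBirkhoffSet` at level `s'` bounds the averages only by rationals above
  -- `s'`, so the crossing levels are moved strictly inside `(p, s)`.
  obtain ⟨p', hp1, hp2⟩ := exists_rat_btwn hps
  obtain ⟨s', hs1, hs2⟩ := exists_rat_btwn hp2
  refine hx p' s' (by exact_mod_cast hs1) ⟨?_, ?_⟩
  · by_contra hcon
    exact h2 ((hupper hcon hs2).mono fun n hn => not_lt.2 hn)
  · by_contra hcon
    have := hlower hcon (r := -p) (by push_cast; linarith)
    refine h1 (this.mono fun n hn => not_lt.2 ?_)
    push_cast at hn
    linarith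

/-- **Birkhoff's pointwise ergodic theorem**, existence of the limit. -/
theorem ae_exists_tendsto_birkhoffSum_div [IsFiniteMeasure μ]
    (hT : MeasurePreserving T μ μ) (hφ : Integrable φ μ) :
    ∀ᵐ x ∂μ, ∃ l, Tendsto (fun n : ℕ => birkhoffSum T φ n x / n) atTop (𝓝 l) := by
  have hae := hφ.aestronglyMeasurable.ae_eq_mk
  have h1 := ae_exists_tendsto_birkhoffSum_div_of_measurable hT
    hφ.aestronglyMeasurable.stronglyMeasurable_mk.measurable (hφ.congr hae)
  have h2 : ∀ᵐ x ∂μ, ∀ n, birkhoffSum T φ n x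
      = birkhoffSum T (hφ.aestronglyMeasurable.mk φ) n x :=
    ae_all_iff.2 fun n => hT.quasiMeasurePreserving.birkhoffSum_ae_eq_of_ae_eq hae n
  filter_upwards [h1, h2] with x hx1 hx2
  simpa only [hx2] using hx1

end MeasureTheory

/-! ### Times of new minima -/

/-- If `T n / n` has a negative limit, the times at which `T` attains a new minimum have gaps of
sublinear length. -/
theorem exists_tendsto_of_isMinimal_times {T : ℕ → ℝ} {a : ℝ} (ha : 0 < a)
    (hT : Tendsto (fun n : ℕ => T n / n) atTop (𝓝 (-a))) (m₀ : ℕ) :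
    ∃ τ : ℕ → ℕ, (∀ n, n ≤ τ n ∧ m₀ ≤ τ n ∧ ∀ k ≤ τ n, T (τ n) ≤ T k) ∧
      Tendsto (fun n : ℕ => (τ n : ℝ) / n) atTop (𝓝 1) := by
  classical
  have herr (e : ℝ) (he : 0 < e) : ∃ C : ℝ, ∀ k : ℕ, |T k + a * k| ≤ e * k + C := by
    obtain ⟨N, hN⟩ := eventually_atTop.1 (Metric.tendsto_nhds.1 hT e he)
    refine ⟨∑ k ∈ Finset.range (N + 1), |T k + a * k|, fun k => ?_⟩
    by_cases hk : k < N + 1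
    · have := Finset.single_le_sum (f := fun k : ℕ => |T k + a * k|) (fun i _ => abs_nonneg _)
        (Finset.mem_range.2 hk)
      have : 0 ≤ e * k := by positivity
      linarith
    · have hpos : (0 : ℝ) < k := by
        have : 0 < k := by omega
        exact_mod_cast this
      have h := hN k (by omega)
      rw [Real.dist_eq, sub_neg_eq_add] at h
      have h' : |T k + a * k| = |T k / k + a| * k := by
        rw [← abs_of_pos hpos, ← abs_mul, abs_of_pos hpos]
        congr 1
        field_simp
      have hsum : 0 ≤ ∑ k ∈ Finset.range (N + 1), |T k + a * k| :=
        Finset.sum_nonneg fun i _ => abs_nonneg _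
      rw [h']
      nlinarith
  have hrec {n m : ℕ} (h : ∀ k ≤ n, T m < T k) :
      ∃ t, n < t ∧ t ≤ m ∧ ∀ k ≤ t, T t ≤ T k := by
    obtain ⟨t, ht, hmin⟩ := Finset.exists_min_image (Finset.range (m + 1)) T ⟨m, by simp⟩
    have htm : t ≤ m := by simpa [Nat.lt_succ_iff] using ht
    refine ⟨t, ?_, htm, fun k hk => hmin k (Finset.mem_range.2 (by omega))⟩
    by_contra hcon
    exact absurd (h t (not_lt.1 hcon)) (not_lt.2 (hmin m (by simp)))
  have hgap (η : ℝ) (hη : 0 < η) : ∀ᶠ n : ℕ in atTop,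
      ∃ t, n < t ∧ (t : ℝ) ≤ (1 + η) * n ∧ ∀ k ≤ t, T t ≤ T k := by
    -- With `m = n + ⌊η * n⌋₊`, the inequality `T m < T k` for `k ≤ n` follows from `2 * C + a < (a
    -- * η - e * (2 + η)) * n`. This `e` makes the coefficient of `n` equal to `a * η / 2`.
    set e := a * η / (2 * (2 + η)) with he_def
    have he : 0 < e := by positivity
    have he2 : e * (2 + η) = a * η / 2 := by
      rw [he_def]; field_simp
    obtain ⟨C, hC⟩ := herr e he
    have hlarge : ∀ᶠ n : ℕ in atTop, 2 * C + a < (a * η / 2) * n :=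
      (tendsto_natCast_atTop_atTop.const_mul_atTop (by positivity)).eventually_gt_atTop _
    filter_upwards [hlarge] with n hn
    have hfl := Nat.floor_le (a := η * n) (by positivity)
    have hfl' := Nat.lt_floor_add_one (η * n)
    obtain ⟨t, h1, h2, h3⟩ := hrec (n := n) (m := n + ⌊η * n⌋₊) (fun k hk => by
      have hm := (abs_le.1 (hC (n + ⌊η * n⌋₊))).2
      have hk1 := (abs_le.1 (hC k)).1
      have hkn : (k : ℝ) ≤ n := by exact_mod_cast hk
      push_cast at hm
      have hae : (a + e) * k ≤ (a + e) * n := by gcongr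
      have hea : e < a := by
        rw [he_def, div_lt_iff₀ (by positivity)]; nlinarith
      have : (a - e) * (η * n - 1) ≤ (a - e) * ⌊η * n⌋₊ :=
        mul_le_mul_of_nonneg_left (by linarith) (by linarith)
      have : e * (2 + η) * n = a * η / 2 * n := by rw [he2]
      nlinarith)
    refine ⟨t, h1, ?_, h3⟩
    have : (t : ℝ) ≤ n + ⌊η * n⌋₊ := by exact_mod_cast h2
    linarith
  have hex (n : ℕ) : ∃ t, n ≤ t ∧ m₀ ≤ t ∧ ∀ k ≤ t, T t ≤ T k := by
    obtain ⟨n', ⟨t, h1, -, h2⟩, hn'⟩ :=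
      ((hgap 1 one_pos).and (eventually_ge_atTop (n + m₀))).exists
    exact ⟨t, by omega, by omega, h2⟩
  refine ⟨fun n => Nat.find (hex n), fun n => Nat.find_spec (hex n), ?_⟩
  refine Metric.tendsto_nhds.2 fun η hη => ?_
  filter_upwards [hgap (η / 2) (by positivity), eventually_ge_atTop m₀, eventually_gt_atTop 0]
    with n hn hnm hn0
  obtain ⟨t, h1, h2, h3⟩ := hn
  have hle : Nat.find (hex n) ≤ t := Nat.find_min' _ ⟨h1.le, by omega, h3⟩
  have hle' : (Nat.find (hex n) : ℝ) ≤ (1 + η / 2) * n := le_trans (by exact_mod_cast hle) h2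
  have hge : (n : ℝ) ≤ Nat.find (hex n) := by exact_mod_cast (Nat.find_spec (hex n)).1
  have hnpos : (0 : ℝ) < n := by exact_mod_cast hn0
  rw [Real.dist_eq, abs_lt]
  have h4 : 1 ≤ (Nat.find (hex n) : ℝ) / n := by rwa [le_div_iff₀ hnpos, one_mul]
  have h5 : (Nat.find (hex n) : ℝ) / n ≤ 1 + η / 2 := by rwa [div_le_iff₀ hnpos]
  constructor <;> linarith

/-! ### From local to uniform Lipschitz bounds -/

/-- Any two points are joined by paths whose length, measured by `ℓ`, is arbitrarily close to their
distance. -/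
def HasShortPaths (M : Type*) [MetricSpace M] : Prop :=
  ∀ (a b : M) (r : ℝ), dist a b < r → ∃ (γ : ℝ → M) (ℓ : ℝ → ℝ), ContinuousOn γ (Icc 0 1) ∧
    γ 0 = a ∧ γ 1 = b ∧ ℓ 0 = 0 ∧ ℓ 1 < r ∧
    ∀ s t, 0 ≤ s → s ≤ t → t ≤ 1 → dist (γ s) (γ t) ≤ ℓ t - ℓ s

theorem hasShortPaths_of_isRiemannianManifold {E : Type*} [NormedAddCommGroup E] [NormedSpace ℝ E]
    {H : Type*} [TopologicalSpace H] (I : ModelWithCorners ℝ E H) (M : Type*) [MetricSpace M]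
    [ChartedSpace H M] [IsManifold I 1 M] [RiemannianBundle (fun x : M => TangentSpace I x)]
    [IsRiemannianManifold I M] : HasShortPaths M := by
  intro a b r hr
  have hr0 : 0 < r := dist_nonneg.trans_lt hr
  have hlt : Manifold.riemannianEDist I a b < ENNReal.ofReal r := by
    rw [← IsRiemannianManifold.out (I := I) a b, edist_dist]
    exact (ENNReal.ofReal_lt_ofReal_iff hr0).2 hr
  obtain ⟨γ, h0, h1, hγ, hlen⟩ := Manifold.exists_lt_of_riemannianEDist_lt hlt
  have hfin (s t : ℝ) (hs : 0 ≤ s) (ht : t ≤ 1) : Manifold.pathELength I γ s t ≠ ⊤ :=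
    ((Manifold.pathELength_mono hs ht).trans_lt (hlen.trans ENNReal.ofReal_lt_top)).ne
  refine ⟨γ, fun t => (Manifold.pathELength I γ 0 t).toReal, hγ.continuousOn, h0, h1, by simp, ?_,
    fun s t hs hst ht => ?_⟩
  · exact (ENNReal.lt_ofReal_iff_toReal_lt (hfin 0 1 le_rfl le_rfl)).1 hlen
  · have hadd := Manifold.pathELength_add (I := I) (γ := γ) hs hst
    have hle : edist (γ s) (γ t) ≤ Manifold.pathELength I γ s t := by
      rw [IsRiemannianManifold.out (I := I)]
      exact Manifold.riemannianEDist_le_pathELength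
        (hγ.mono (Icc_subset_Icc hs ht)) rfl rfl hst
    beta_reduce
    rw [← hadd, ENNReal.toReal_add (hfin 0 s le_rfl (hst.trans ht)) (hfin s t hs ht),
      add_sub_cancel_left, dist_edist]
    exact ENNReal.toReal_mono (hfin s t hs ht) hle

/-- The local bounds add up along a fine subdivision of the path, which exists by compactness of
`[0, 1]`; the increments of `ℓ` telescope. -/
theorem dist_le_mul_length_of_locally_lipschitz {M N : Type*} [MetricSpace M] [MetricSpace N]
    {g : M → N} {γ : ℝ → M} {ℓ : ℝ → ℝ} {C : ℝ} (hC : 0 ≤ C) (hγ : ContinuousOn γ (Icc 0 1))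
    (hℓ : ∀ s t, 0 ≤ s → s ≤ t → t ≤ 1 → dist (γ s) (γ t) ≤ ℓ t - ℓ s)
    (hg : ∀ t ∈ Icc (0 : ℝ) 1, ∃ U ∈ 𝓝 (γ t), ∀ u ∈ U, ∀ v ∈ U,
      dist (g u) (g v) ≤ C * dist u v) :
    dist (g (γ 0)) (g (γ 1)) ≤ C * (ℓ 1 - ℓ 0) := by
  choose! U hU hUg using hg
  have hcont : Continuous fun t : unitInterval => γ t := hγ.domRestrict
  obtain ⟨t, ht0, hmono, ⟨m, hm⟩, hsub⟩ := exists_monotone_Icc_subset_open_cover_unitInterval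
    (c := fun s : unitInterval => (fun t : unitInterval => γ t) ⁻¹' interior (U s))
    (fun s => isOpen_interior.preimage hcont)
    (fun s _ => mem_iUnion.2 ⟨s, mem_interior_iff_mem_nhds.2 (hU s s.2)⟩)
  have hind : ∀ n, dist (g (γ 0)) (g (γ (t n))) ≤ C * (ℓ (t n) - ℓ 0) := by
    intro n
    induction n with
    | zero => simp [ht0]
    | succ n ih =>
      obtain ⟨i, hi⟩ := hsub n
      have hle : t n ≤ t (n + 1) := hmono n.le_succ
      have h1 := hUg i i.2 _ (interior_subset (hi ⟨le_rfl, hle⟩)) _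
        (interior_subset (hi ⟨hle, le_rfl⟩))
      have h2 := mul_le_mul_of_nonneg_left
        (hℓ (t n) (t (n + 1)) (t n).2.1 hle (t (n + 1)).2.2) hC
      have h3 := dist_triangle (g (γ 0)) (g (γ (t n))) (g (γ (t (n + 1))))
      linarith
  simpa [hm m le_rfl] using hind m

/-- A path of length below `2 * r` that starts in the ball of radius `r` stays in the ball of radius
`3 * r`. Letting the length tend to `dist u v` gives the constant `C` itself. -/
theorem HasShortPaths.dist_le_of_locally_lipschitz {M N : Type*} [MetricSpace M] [MetricSpace N]
    (hM : HasShortPaths M) {g : M → N} {C r : ℝ} (hC : 0 ≤ C) {x : M}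
    (hg : ∀ z ∈ Metric.ball x (3 * r), ∃ U ∈ 𝓝 z, ∀ u ∈ U, ∀ v ∈ U,
      dist (g u) (g v) ≤ C * dist u v) {u v : M} (hu : u ∈ Metric.ball x r)
    (hv : v ∈ Metric.ball x r) : dist (g u) (g v) ≤ C * dist u v := by
  have huv : dist u v < 2 * r := by
    have := dist_triangle_right u v x
    rw [Metric.mem_ball] at hu hv
    linarith
  have hlim : Tendsto (fun s : ℝ => C * s) (𝓝[>] dist u v) (𝓝 (C * dist u v)) :=
    ((continuous_const.mul continuous_id).tendsto _).mono_left nhdsWithin_le_nhds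
  refine ge_of_tendsto hlim ?_
  filter_upwards [Ioo_mem_nhdsGT huv] with s hs
  obtain ⟨γ, ℓ, hγ, h0, h1, hℓ0, hℓ1, hℓ⟩ := hM u v s hs.1
  have key := dist_le_mul_length_of_locally_lipschitz hC hγ hℓ (g := g) fun t ht => hg _ (by
    have h2 := hℓ 0 t le_rfl ht.1 ht.2
    have h3 := dist_nonneg.trans (hℓ t 1 ht.1 ht.2 le_rfl)
    have h4 := dist_triangle_left (γ t) x u
    rw [h0, hℓ0] at h2
    rw [Metric.mem_ball] at hu ⊢
    linarith [hs.2])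
  rw [h0, h1, hℓ0, sub_zero] at key
  exact key.trans (mul_le_mul_of_nonneg_left hℓ1.le hC)

/-! ### Sections of local homeomorphisms on balls of uniform radius -/

/-- Every point of a manifold has an open neighbourhood on which every local homeomorphism of a
compact Hausdorff space to the manifold has continuous sections through all points above it. -/
theorem exists_isOpen_forall_exists_section {E M N : Type*} [NormedAddCommGroup E]
    [NormedSpace ℝ E] [TopologicalSpace M] [T2Space M] [ChartedSpace E M] [TopologicalSpace N]
    [T2Space N] [CompactSpace N] (x : M) :
    ∃ V : Set M, IsOpen V ∧ x ∈ V ∧ ∀ p : N → M, IsLocalHomeomorph p → ∀ a, p a ∈ V →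
      ∃ g : M → N, ContinuousOn g V ∧ g (p a) = a ∧ ∀ u ∈ V, p (g u) = u := by
  classical
  set e := chartAt E x
  obtain ⟨r, hr, hball⟩ := Metric.isOpen_iff.1 e.open_target (e x) (mem_chart_target E x)
  have : SimplyConnectedSpace (Metric.ball (e x) r) := by
    have := Metric.contractibleSpace_ball (x := e x) hr
    infer_instance
  have : LocallyPathConnectedSpace (Metric.ball (e x) r) :=
    Metric.isOpen_ball.locallyPathConnectedSpace
  let φ : C(Metric.ball (e x) r, M) :=
    ⟨fun u => e.symm u, (e.continuousOn_symm.mono hball).domRestrict⟩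
  refine ⟨e.source ∩ e ⁻¹' Metric.ball (e x) r, e.isOpen_inter_preimage Metric.isOpen_ball,
    ⟨mem_chart_source E x, Metric.mem_ball_self hr⟩, fun p hp a ha => ?_⟩
  -- Compactness of `N` makes `p` a covering map, so the inverse chart on a simply connected ball
  -- lifts through `p`. The ball depends on the chart alone, not on `p`.
  have hcov : IsCoveringMap p := isCoveringMap_iff_isCoveringMapOn_univ.2
    (IsCoveringMapOn.of_isLocalHomeomorphOn hp.continuous fun y _ => hp y)
  obtain ⟨F, ⟨hF0, hF⟩, -⟩ := hcov.existsUnique_continuousMap_lifts φ ⟨e (p a), ha.2⟩ a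
    (e.left_inv ha.1).symm
  refine ⟨fun u => if h : e u ∈ Metric.ball (e x) r then F ⟨e u, h⟩ else a, ?_, ?_, ?_⟩
  · rw [continuousOn_iff_continuous_domRestrict]
    have hc : Continuous fun u : ↥(e.source ∩ e ⁻¹' Metric.ball (e x) r) =>
        F ⟨e u, u.2.2⟩ :=
      F.continuous.comp ((e.continuousOn.mono inter_subset_left).domRestrict.subtype_mk _)
    refine hc.congr fun u => ?_
    rw [domRestrict_apply, dif_pos (show e u ∈ Metric.ball (e x) r from u.2.2)]
  · have := ha.2
    rw [mem_preimage] at this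
    simp only [this, dif_pos, hF0]
  · rintro u ⟨hu1, hu2⟩
    rw [mem_preimage] at hu2
    simp only [hu2, dif_pos]
    exact (congrFun hF ⟨e u, hu2⟩).trans (e.left_inv hu1)

/-- On a compact manifold there is a radius such that all local homeomorphisms from a compact space
have continuous sections on the balls of this radius. -/
theorem exists_radius_forall_exists_section (E M N : Type*) [NormedAddCommGroup E]
    [NormedSpace ℝ E] [MetricSpace M] [CompactSpace M] [ChartedSpace E M] [TopologicalSpace N]
    [T2Space N] [CompactSpace N] :
    ∃ ρ : ℝ, 0 < ρ ∧ ∀ p : N → M, IsLocalHomeomorph p → ∀ a, ∃ g : M → N,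
      ContinuousOn g (Metric.ball (p a) ρ) ∧ g (p a) = a ∧
      ∀ u ∈ Metric.ball (p a) ρ, p (g u) = u := by
  choose V hVo hxV hV using
    exists_isOpen_forall_exists_section (E := E) (M := M) (N := N)
  obtain ⟨ρ, hρ, hleb⟩ := lebesgue_number_lemma_of_metric (isCompact_univ (X := M)) hVo
    fun x _ => mem_iUnion.2 ⟨x, hxV x⟩
  refine ⟨ρ, hρ, fun p hp a => ?_⟩
  obtain ⟨i, hi⟩ := hleb (p a) (mem_univ _)
  obtain ⟨g, hg1, hg2, hg3⟩ := hV i p hp a (hi (Metric.mem_ball_self hρ))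
  exact ⟨g, hg1.mono hi, hg2, fun u hu => hg3 u (hi hu)⟩

/-- A continuous section of a map with locally Lipschitz inverse branches is Lipschitz on small
balls, with a constant that bounds the local constants near the image of the centre. -/
theorem HasShortPaths.dist_section_le {M N : Type*} [MetricSpace M] [MetricSpace N]
    (hM : HasShortPaths M) {p : N → M} {L : N → ℝ}
    (hp : ∀ x, ∃ U ∈ 𝓝 x, ∀ a ∈ U, ∀ b ∈ U, dist a b ≤ L x * dist (p a) (p b))
    {g : M → N} {a : N} {ρ : ℝ} (hg : ContinuousOn g (Metric.ball (p a) ρ)) (hga : g (p a) = a)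
    (hpg : ∀ u ∈ Metric.ball (p a) ρ, p (g u) = u) {Λ δ C r : ℝ} (hΛ : 0 < Λ)
    (hL : ∀ x, L x ≤ Λ) (hr : 9 * r ≤ ρ) (hδ : Λ * (3 * r) ≤ δ) (hC : 0 ≤ C)
    (hLC : ∀ z ∈ Metric.ball a δ, L z ≤ C) {u v : M} (hu : u ∈ Metric.ball (p a) r)
    (hv : v ∈ Metric.ball (p a) r) : dist (g u) (g v) ≤ C * dist u v := by
  have hr0 : 0 < r := dist_nonneg.trans_lt (Metric.mem_ball.1 hu)
  have hloc {B : ℝ} {z : M} (hz : z ∈ Metric.ball (p a) ρ) (hB : L (g z) ≤ B) :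
      ∃ U ∈ 𝓝 z, ∀ u ∈ U, ∀ v ∈ U, dist (g u) (g v) ≤ B * dist u v := by
    obtain ⟨U, hU, hUL⟩ := hp (g z)
    have hball : Metric.ball (p a) ρ ∈ 𝓝 z := Metric.isOpen_ball.mem_nhds hz
    refine ⟨_, inter_mem ((hg.continuousAt hball).preimage_mem_nhds hU) hball, ?_⟩
    rintro u ⟨hu1, hu2⟩ v ⟨hv1, hv2⟩
    have h := hUL _ hu1 _ hv1
    rw [hpg u hu2, hpg v hv2] at h
    exact h.trans (mul_le_mul_of_nonneg_right hB dist_nonneg)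
  -- Two passes: the crude constant `Λ` on the ball of radius `3 * r`, which needs radius `9 * r`,
  -- keeps the values of `g` within `δ` of `a`; there `C` bounds `L`.
  refine hM.dist_le_of_locally_lipschitz hC (fun z hz => hloc ?_ (hLC _ ?_)) hu hv
  · exact Metric.ball_subset_ball (by linarith) hz
  · have h := hM.dist_le_of_locally_lipschitz (g := g) (r := 3 * r) hΛ.le
      (fun y hy => hloc (Metric.ball_subset_ball (by linarith) hy) (hL _)) hz
      (Metric.mem_ball_self (by positivity))
    rw [hga] at h
    exact Metric.mem_ball.2 ((h.trans_lt (mul_lt_mul_of_pos_left (Metric.mem_ball.1 hz) hΛ)).trans_le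
      hδ)

/-! ### Inverse branches and periodic points -/

namespace RandomSpec

theorem fiberIterate_add {X M : Type*} (θ : X → X) (f : X → M → M) (m n : ℕ) (w : X) (x : M) :
    fiberIterate θ f (m + n) w x = fiberIterate θ f n (θ^[m] w) (fiberIterate θ f m w x) := by
  induction n with
  | zero => rfl
  | succ n ih =>
    change f (θ^[m + n] w) (fiberIterate θ f (m + n) w x) = f (θ^[n] (θ^[m] w)) _
    rw [ih, add_comm m n, Function.iterate_add_apply]

theorem skewProduct_iterate {X M : Type*} (θ : X → X) (f : X → M → M) (n : ℕ) (z : X × M) :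
    (skewProduct θ f)^[n] z = (θ^[n] z.1, fiberIterate θ f n z.1 z.2) := by
  induction n with
  | zero => rfl
  | succ n ih => rw [Function.iterate_succ_apply', ih, Function.iterate_succ_apply']; rfl

/-- Lipschitz sections along an orbit compose to an inverse branch of the iterate. -/
theorem exists_inverse_branch {X M : Type*} [MetricSpace M] {θ : X → X} {f : X → M → M} {w : X}
    {x : M} {c : ℕ → ℝ} (hc : ∀ j, 0 < c j) {ρ : ℝ} (n : ℕ)
    (hstep : ∀ j < n, ∃ g : M → M, g (fiberIterate θ f (j + 1) w x) = fiberIterate θ f j w x ∧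
      ∀ u ∈ Metric.ball (fiberIterate θ f (j + 1) w x) ρ, f (θ^[j] w) (g u) = u ∧
        ∀ v ∈ Metric.ball (fiberIterate θ f (j + 1) w x) ρ, dist (g u) (g v) ≤ c j * dist u v)
    {r : ℝ} (hr : ∀ k ≤ n, (∏ j ∈ Finset.Ico k n, c j) * r ≤ ρ) :
    ∃ h : M → M, h (fiberIterate θ f n w x) = x ∧
      ∀ u ∈ Metric.ball (fiberIterate θ f n w x) r, fiberIterate θ f n w (h u) = u ∧
        ∀ v ∈ Metric.ball (fiberIterate θ f n w x) r, ∀ k ≤ n,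
          dist (fiberIterate θ f k w (h u)) (fiberIterate θ f k w (h v)) ≤
            (∏ j ∈ Finset.Ico k n, c j) * dist u v := by
  induction n generalizing r with
  | zero =>
    refine ⟨id, rfl, fun u _ => ⟨rfl, fun v _ k hk => ?_⟩⟩
    obtain rfl : k = 0 := by omega
    simp [fiberIterate]
  | succ n ih =>
    -- The last section sends the ball of radius `r` into one of radius `c n * r`, so `c n` moves
    -- from the product into the radius.
    obtain ⟨h, hx, hh⟩ := ih (fun j hj => hstep j (by omega)) (r := c n * r) fun k hk => by
      rw [← mul_assoc, ← Finset.prod_Ico_succ_top hk]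
      exact hr k (by omega)
    obtain ⟨g, hgx, hg⟩ := hstep n n.lt_succ_self
    have hrρ : r ≤ ρ := by simpa using hr (n + 1) le_rfl
    have hsub := Metric.ball_subset_ball (x := fiberIterate θ f (n + 1) w x) hrρ
    have hmem {u : M} (hu : u ∈ Metric.ball (fiberIterate θ f (n + 1) w x) r) :
        g u ∈ Metric.ball (fiberIterate θ f n w x) (c n * r) := by
      have hr0 : 0 < r := dist_nonneg.trans_lt (Metric.mem_ball.1 hu)
      rw [Metric.mem_ball, ← hgx]
      exact ((hg u (hsub hu)).2 _ (hsub (Metric.mem_ball_self hr0))).trans_lt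
        (mul_lt_mul_of_pos_left (Metric.mem_ball.1 hu) (hc n))
    refine ⟨h ∘ g, (congrArg h hgx).trans hx, fun u hu => ?_⟩
    have htop {u : M} (hu : u ∈ Metric.ball (fiberIterate θ f (n + 1) w x) r) :
        fiberIterate θ f (n + 1) w (h (g u)) = u := by
      change f (θ^[n] w) (fiberIterate θ f n w (h (g u))) = u
      rw [(hh _ (hmem hu)).1, (hg u (hsub hu)).1]
    refine ⟨htop hu, fun v hv k hk => ?_⟩
    rcases Nat.lt_succ_iff_lt_or_eq.1 (Nat.lt_succ_of_le hk) with hk' | rfl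
    · have hkn : k ≤ n := by omega
      rw [Finset.prod_Ico_succ_top hkn, mul_assoc]
      refine ((hh _ (hmem hu)).2 _ (hmem hv) k hkn).trans ?_
      exact mul_le_mul_of_nonneg_left ((hg u (hsub hu)).2 v (hsub hv))
        (Finset.prod_nonneg fun j _ => (hc j).le)
    · simp only [Function.comp_apply, htop hu, htop hv]
      simp

/-- An inverse branch of the first `m` steps that contracts strongly enough, followed backwards by
an inverse branch of the next `N` steps defined near `x`, has a fixed point. -/
theorem exists_periodic_of_inverse_branches {X M : Type*} [MetricSpace M] [CompactSpace M]
    {θ : X → X} {f : X → M → M} {w : X} {x y : M} {m N : ℕ} {h s : M → M} {r₁ r₂ Q B : ℝ}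
    (hr₂ : 0 < r₂) (hB : 0 < B) (hQ : 0 ≤ Q)
    (hhx : h (fiberIterate θ f m w x) = x)
    (hh : ∀ u ∈ Metric.ball (fiberIterate θ f m w x) r₁, fiberIterate θ f m w (h u) = u ∧
      (∀ v ∈ Metric.ball (fiberIterate θ f m w x) r₁, dist (h u) (h v) ≤ Q * dist u v) ∧
      ∀ k ≤ m, dist (fiberIterate θ f k w (h u)) (fiberIterate θ f k w x) ≤
        dist u (fiberIterate θ f m w x))
    (hsx : s x = y) (hy : dist y (fiberIterate θ f m w x) < r₁ / 2)
    (hs : ∀ u ∈ Metric.ball x r₂, fiberIterate θ f N (θ^[m] w) (s u) = u ∧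
      ∀ v ∈ Metric.ball x r₂, dist (s u) (s v) ≤ B * dist u v)
    (hBr : B * r₂ ≤ r₁ / 2) (hQr : Q * r₁ ≤ r₂ / 2) (hQB : Q * B < 1) :
    ∃ p ∈ dynamicalBall θ f m w x r₁, fiberIterate θ f (m + N) w p = p := by
  have hr₁ : 0 < r₁ := by nlinarith
  have hxm := Metric.mem_ball_self (x := fiberIterate θ f m w x) hr₁
  have hsub : Metric.closedBall x (r₂ / 2) ⊆ Metric.ball x r₂ :=
    Metric.closedBall_subset_ball (by linarith)
  have hsmem {u : M} (hu : u ∈ Metric.ball x r₂) :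
      s u ∈ Metric.ball (fiberIterate θ f m w x) r₁ := by
    have h1 := (hs u hu).2 x (Metric.mem_ball_self hr₂)
    have h2 := mul_lt_mul_of_pos_left (Metric.mem_ball.1 hu) hB
    have h3 := dist_triangle (s u) y (fiberIterate θ f m w x)
    rw [hsx] at h1
    exact Metric.mem_ball.2 (by linarith)
  have hmaps : MapsTo (h ∘ s) (Metric.closedBall x (r₂ / 2)) (Metric.closedBall x (r₂ / 2)) := by
    intro u hu
    have h1 := hsmem (hsub hu)
    have h2 := (hh _ h1).2.1 _ hxm
    rw [hhx] at h2
    exact Metric.mem_closedBall.2 (h2.trans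
      ((mul_le_mul_of_nonneg_left (Metric.mem_ball.1 h1).le hQ).trans hQr))
  have hcontr : ContractingWith (Q * B).toNNReal
      (hmaps.restrict (h ∘ s) (Metric.closedBall x (r₂ / 2)) (Metric.closedBall x (r₂ / 2))) := by
    refine ⟨by rw [Real.toNNReal_lt_one]; exact hQB, LipschitzWith.of_dist_le_mul fun u v => ?_⟩
    rw [Real.coe_toNNReal _ (by positivity), mul_assoc]
    exact ((hh _ (hsmem (hsub u.2))).2.1 _ (hsmem (hsub v.2))).trans
      (mul_le_mul_of_nonneg_left ((hs _ (hsub u.2)).2 _ (hsub v.2)) hQ)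
  obtain ⟨p, hp, hfix, -⟩ := hcontr.exists_fixedPoint' Metric.isClosed_closedBall.isComplete hmaps
    (Metric.mem_closedBall_self (by positivity : 0 ≤ r₂ / 2)) (edist_ne_top _ _)
  have hps : h (s p) = p := hfix
  have hsp := hsmem (hsub hp)
  refine ⟨p, ?_, ?_⟩
  · simp only [dynamicalBall, mem_iInter, mem_preimage, Finset.mem_range]
    intro k hk
    have := (hh _ hsp).2.2 k (by omega)
    rw [hps] at this
    exact this.trans_lt hsp
  · conv_lhs => rw [← hps]
    rw [fiberIterate_add, (hh _ hsp).1, (hs p (hsub hp)).1]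

theorem dynamicalBall_subset {X M : Type*} [MetricSpace M] {θ : X → X} {f : X → M → M} {w : X}
    {x : M} {m n : ℕ} {r ε : ℝ} (hmn : n ≤ m) (hr : r ≤ ε) :
    dynamicalBall θ f m w x r ⊆ dynamicalBall θ f n w x ε := by
  intro p hp
  simp only [dynamicalBall, mem_iInter, mem_preimage, Finset.mem_range] at hp ⊢
  exact fun k hk => Metric.ball_subset_ball hr (hp k (by omega))

/-- Periodic points in the dynamical balls of a point, from the times at which the sums of
`log L + c` along its orbit attain a new minimum. -/
theorem exists_periodic_of_isMinimal_times {X M : Type*} [MetricSpace M] [CompactSpace M]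
    (hM : HasShortPaths M) {θ : X → X} {f : X → M → M} {L : X → M → ℝ} {w : X} {x : M} {ρ : ℝ}
    (hρ : 0 < ρ)
    (hsec : ∀ w a, ∃ g : M → M, ContinuousOn g (Metric.ball (f w a) ρ) ∧ g (f w a) = a ∧
      ∀ u ∈ Metric.ball (f w a) ρ, f w (g u) = u)
    (hloc : ∀ w x, ∃ U ∈ 𝓝 x, ∀ a ∈ U, ∀ b ∈ U, dist a b ≤ L w x * dist (f w a) (f w b))
    (hLpos : ∀ w x, 0 < L w x) {Λ : ℝ} (hΛ : 1 ≤ Λ) (hLΛ : ∀ j x, L (θ^[j] w) x ≤ Λ)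
    {c : ℝ} (hc : 0 < c) {δ : ℝ} (hδ : 0 < δ)
    (hdist : ∀ j, ∀ a, ∀ z ∈ Metric.ball a δ,
      L (θ^[j] w) z ≤ Real.exp (c / 2) * L (θ^[j] w) a)
    (hexact : ∀ ε : ℝ, 0 < ε → ∃ N : ℕ, 1 ≤ N ∧ ∀ j,
      fiberIterate θ f N (θ^[j] w) '' Metric.ball (fiberIterate θ f j w x) ε = univ)
    {ε : ℝ} (hε : 0 < ε) :
    ∃ m₀ N : ℕ, 1 ≤ N ∧ ∀ m, m₀ ≤ m →
      (∀ k ≤ m, ∑ j ∈ Finset.range m, (Real.log (L (θ^[j] w) (fiberIterate θ f j w x)) + c) ≤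
        ∑ j ∈ Finset.range k, (Real.log (L (θ^[j] w) (fiberIterate θ f j w x)) + c)) →
      ∃ p ∈ dynamicalBall θ f m w x ε, fiberIterate θ f (m + N) w p = p := by
  have hΛ0 : 0 < Λ := by linarith
  -- The three bounds serve the shadowing and the two radius conditions of
  -- `HasShortPaths.dist_section_le`.
  set r₁ : ℝ := min ε (min (ρ / 9) (δ / (3 * Λ)))
  have hr₁ : 0 < r₁ := by positivity
  have hr₁ε : r₁ ≤ ε := min_le_left _ _
  have hr₁ρ : 9 * r₁ ≤ ρ := by
    have : r₁ ≤ ρ / 9 := (min_le_right _ _).trans (min_le_left _ _)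
    linarith
  have hr₁δ : Λ * (3 * r₁) ≤ δ := by
    have : r₁ ≤ δ / (3 * Λ) := (min_le_right _ _).trans (min_le_right _ _)
    rw [le_div_iff₀ (by positivity)] at this
    linarith
  have hstep (j : ℕ) (a : M) {C : ℝ} (hC : 0 ≤ C)
      (hLC : ∀ z ∈ Metric.ball a δ, L (θ^[j] w) z ≤ C) :
      ∃ g : M → M, g (f (θ^[j] w) a) = a ∧ ∀ u ∈ Metric.ball (f (θ^[j] w) a) r₁,
        f (θ^[j] w) (g u) = u ∧
        ∀ v ∈ Metric.ball (f (θ^[j] w) a) r₁, dist (g u) (g v) ≤ C * dist u v := by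
    obtain ⟨g, hg1, hg2, hg3⟩ := hsec (θ^[j] w) a
    exact ⟨g, hg2, fun u hu => ⟨hg3 u (Metric.ball_subset_ball (by linarith) hu), fun v hv =>
      hM.dist_section_le (hloc _) hg1 hg2 hg3 hΛ0 (hLΛ j) hr₁ρ hr₁δ hC hLC hu hv⟩⟩
  obtain ⟨N, hN1, hN⟩ := hexact (r₁ / 2) (by positivity)
  set B : ℝ := Λ ^ N
  have hB : 0 < B := by positivity
  have hB1 : 1 ≤ B := one_le_pow₀ hΛ
  set r₂ : ℝ := r₁ / (2 * B)
  have hr₂ : 0 < r₂ := by positivity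
  have hBr : B * r₂ = r₁ / 2 := by simp only [r₂]; field_simp
  have hQlim : Tendsto (fun m : ℕ => Real.exp (-(c / 2)) ^ m) atTop (𝓝 0) :=
    tendsto_pow_atTop_nhds_zero_of_lt_one (Real.exp_pos _).le (Real.exp_lt_one_iff.2 (by linarith))
  -- From `m₀` on, the composed branch maps the closed ball of radius `r₂ / 2` into itself and is a
  -- contraction.
  obtain ⟨m₀, hm₀⟩ := eventually_atTop.1 (((by simpa using hQlim.mul_const r₁ :
    Tendsto (fun m : ℕ => Real.exp (-(c / 2)) ^ m * r₁) atTop (𝓝 0)).eventually_lt_const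
      (by positivity : 0 < r₂ / 2)).and ((by simpa using hQlim.mul_const B :
    Tendsto (fun m : ℕ => Real.exp (-(c / 2)) ^ m * B) atTop (𝓝 0)).eventually_lt_const one_pos))
  refine ⟨m₀, N, hN1, fun m hm hmin => ?_⟩
  obtain ⟨hQr, hQB⟩ := hm₀ m hm
  set κ : ℕ → ℝ := fun j => Real.exp (c / 2) * L (θ^[j] w) (fiberIterate θ f j w x)
  have hκ (j : ℕ) : 0 < κ j := mul_pos (Real.exp_pos _) (hLpos _ _)
  have hprod (k : ℕ) (hk : k ≤ m) :
      ∏ j ∈ Finset.Ico k m, κ j ≤ Real.exp (-(c / 2)) ^ (m - k) := by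
    have h1 : ∏ j ∈ Finset.Ico k m, κ j = Real.exp (∑ j ∈ Finset.Ico k m,
        (Real.log (L (θ^[j] w) (fiberIterate θ f j w x)) + c / 2)) := by
      rw [Real.exp_sum]
      refine Finset.prod_congr rfl fun j _ => ?_
      rw [Real.exp_add, Real.exp_log (hLpos _ _), mul_comm]
    rw [h1, ← Real.exp_nat_mul, Real.exp_le_exp]
    have h2 := hmin k hk
    rw [← sub_nonpos, ← Finset.sum_Ico_eq_sub _ hk, Finset.sum_add_distrib, Finset.sum_const,
      Nat.card_Ico, nsmul_eq_mul] at h2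
    rw [Finset.sum_add_distrib, Finset.sum_const, Nat.card_Ico, nsmul_eq_mul]
    linarith
  have hprod1 (k : ℕ) (hk : k ≤ m) : ∏ j ∈ Finset.Ico k m, κ j ≤ 1 :=
    (hprod k hk).trans (pow_le_one₀ (Real.exp_pos _).le (Real.exp_lt_one_iff.2 (by linarith)).le)
  obtain ⟨h, hhx, hh⟩ := exists_inverse_branch hκ m (ρ := r₁)
    (fun j _ => hstep j (fiberIterate θ f j w x) (hκ j).le fun z hz => hdist j _ z hz)
    (r := r₁) fun k hk => mul_le_of_le_one_left hr₁.le (hprod1 k hk)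
  obtain ⟨y, hy, hyx⟩ : x ∈ fiberIterate θ f N (θ^[m] w) ''
    Metric.ball (fiberIterate θ f m w x) (r₁ / 2) := by rw [hN m]; exact mem_univ x
  have hpow (k : ℕ) (hk : k ≤ N) : ∏ _j ∈ Finset.Ico k N, Λ ≤ B := by
    rw [Finset.prod_const, Nat.card_Ico]
    exact pow_le_pow_right₀ hΛ (Nat.sub_le _ _)
  obtain ⟨s, hsx, hs⟩ := exists_inverse_branch (θ := θ) (f := f) (w := θ^[m] w) (x := y)
    (c := fun _ => Λ) (fun _ => hΛ0) N (ρ := r₁)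
    (fun j _ => by
      have := hstep (j + m) (fiberIterate θ f j (θ^[m] w) y) hΛ0.le fun z _ => hLΛ _ z
      rw [Function.iterate_add_apply] at this
      exact this)
    (r := r₂) fun k hk => by
      have := mul_le_mul_of_nonneg_right (hpow k hk) hr₂.le
      linarith
  rw [hyx] at hsx hs
  have key := exists_periodic_of_inverse_branches (r₁ := r₁) (r₂ := r₂)
    (Q := Real.exp (-(c / 2)) ^ m) (B := B) hr₂ hB (by positivity) hhx
    (fun u hu => ⟨(hh u hu).1, fun v hv => ((hh u hu).2 v hv 0 m.zero_le).trans
      (mul_le_mul_of_nonneg_right (hprod 0 m.zero_le) dist_nonneg), fun k hk => by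
        have := (hh u hu).2 _ (Metric.mem_ball_self hr₁) k hk
        rw [hhx] at this
        exact this.trans (mul_le_of_le_one_left dist_nonneg (hprod1 k hk))⟩) hsx hy
    (fun u hu => ⟨(hs u hu).1, fun v hv => ((hs u hu).2 v hv 0 N.zero_le).trans
      (mul_le_mul_of_nonneg_right (hpow 0 N.zero_le) dist_nonneg)⟩) hBr.le hQr.le hQB
  obtain ⟨p, hp, hfix⟩ := key
  exact ⟨p, dynamicalBall_subset le_rfl hr₁ε hp, hfix⟩

/-- Almost every point of an expanding invariant measure has sublinearly spaced times at which the
sums of `log L + c` along its orbit attain a new minimum. -/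
theorem IsExpanding.ae_exists_minimal_times {X M : Type*} [MeasurableSpace X] [MeasurableSpace M]
    {θ : X → X} {f : X → M → M} {L : X → M → ℝ} {μ : Measure (X × M)} [IsFiniteMeasure μ]
    (hexp : IsExpanding θ f L μ) (hinv : MeasurePreserving (skewProduct θ f) μ μ)
    (hint : Integrable (fun z : X × M => Real.log (L z.1 z.2)) μ) :
    ∃ c : ℝ, 0 < c ∧ ∀ᵐ z ∂μ, ∀ m₀ : ℕ, ∃ τ : ℕ → ℕ,
      (∀ n, n ≤ τ n ∧ m₀ ≤ τ n ∧ ∀ k ≤ τ n,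
        ∑ j ∈ Finset.range (τ n),
          (Real.log (L (θ^[j] z.1) (fiberIterate θ f j z.1 z.2)) + c) ≤
        ∑ j ∈ Finset.range k,
          (Real.log (L (θ^[j] z.1) (fiberIterate θ f j z.1 z.2)) + c)) ∧
      Tendsto (fun n : ℕ => (τ n : ℝ) / n) atTop (𝓝 1) := by
  obtain ⟨c, hc, hlim⟩ := hexp
  refine ⟨c, hc, ?_⟩
  filter_upwards [hlim, ae_exists_tendsto_birkhoffSum_div hinv hint] with z hz hbirk m₀
  obtain ⟨l, hl⟩ := hbirk
  have hsum (n : ℕ) : birkhoffSum (skewProduct θ f) (fun z : X × M => Real.log (L z.1 z.2)) n z =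
      ∑ j ∈ Finset.range n, Real.log (L (θ^[j] z.1) (fiberIterate θ f j z.1 z.2)) := by
    simp only [birkhoffSum, skewProduct_iterate]
  simp only [hsum] at hl
  have hl' : Tendsto (fun n : ℕ => (((1 / (n : ℝ)) *
      ∑ j ∈ Finset.range n, Real.log (L (θ^[j] z.1) (fiberIterate θ f j z.1 z.2)) : ℝ) : EReal))
      atTop (𝓝 (l : EReal)) := by
    refine (continuous_coe_real_ereal.tendsto l).comp (hl.congr fun n => ?_)
    rw [div_eq_inv_mul, one_div]
  -- The limsup is the limit `l`, so `l ≤ -2 * c` and the averages of `log L + c` tend to `l + c ≤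
  -- -c < 0`.
  rw [hl'.limsup_eq, EReal.coe_le_coe_iff] at hz
  refine exists_tendsto_of_isMinimal_times (T := fun n => ∑ j ∈ Finset.range n,
    (Real.log (L (θ^[j] z.1) (fiberIterate θ f j z.1 z.2)) + c)) (a := -(l + c)) (by linarith) ?_ m₀
  rw [neg_neg]
  refine (hl.add_const c).congr' ?_
  filter_upwards [eventually_gt_atTop 0] with n hn
  have : (n : ℝ) ≠ 0 := by exact_mod_cast hn.ne'
  rw [Finset.sum_add_distrib, Finset.sum_const, Finset.card_range, nsmul_eq_mul]
  field_simp

theorem limsup_return_gap_eq_zero {τ : ℕ → ℕ} (hτ : ∀ n, n ≤ τ n) (N : ℕ)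
    (hlim : Tendsto (fun n : ℕ => (τ n : ℝ) / n) atTop (𝓝 1)) :
    limsup (fun n : ℕ => ((((τ n + N - n : ℕ) : ℝ) / (n : ℝ) : ℝ) : EReal)) atTop = 0 := by
  have h1 : Tendsto (fun n : ℕ => (τ n : ℝ) / n + N / n - 1) atTop (𝓝 0) := by
    simpa using (hlim.add (tendsto_const_div_atTop_nhds_zero_nat (N : ℝ))).sub_const 1
  refine ((continuous_coe_real_ereal.tendsto 0).comp (h1.congr' ?_)).limsup_eq
  filter_upwards [eventually_gt_atTop 0] with n hn
  have : (n : ℝ) ≠ 0 := by exact_mod_cast hn.ne'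
  rw [Nat.cast_sub ((hτ n).trans (Nat.le_add_right _ _))]
  push_cast
  field_simp

end RandomSpec

/-! ### The specification property -/

theorem theoremA {d : ℕ} {M : Type*} [MetricSpace M]
    [ChartedSpace (EuclideanSpace ℝ (Fin d)) M] [IsManifold (𝓡 d) ∞ M]
    [RiemannianBundle (fun x : M => TangentSpace (𝓡 d) x)]
    [IsContMDiffRiemannianBundle (𝓡 d) ∞ (EuclideanSpace ℝ (Fin d))
      (fun x : M => TangentSpace (𝓡 d) x)]
    [IsRiemannianManifold (𝓡 d) M] [CompactSpace M] [ConnectedSpace M]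
    [MeasurableSpace M] [BorelSpace M]
    {X : Type*} [MeasurableSpace X] (P : Measure X) [IsProbabilityMeasure P]
    (θ : X ≃ᵐ X) (f : X → M → M) (L : X → M → ℝ)
    (A : X → Set M) (Lsup σ : X → ℝ) (q : X → ℕ)
    (hsys : RandomSpec.IsRandomSystem P θ f L)
    (hgen : RandomSpec.GeneratingConditions P θ f L A Lsup σ q)
    (hreg : RandomSpec.RegularityConditions P θ f L)
    (μ : Measure (X × M)) (hμ : RandomSpec.IsInvariantOver P θ f μ)
    (hexp : RandomSpec.IsExpanding θ f L μ) :
    RandomSpec.NonuniformSpecification θ f μ := by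
  classical
  have := hμ.isProbabilityMeasure
  have hM : HasShortPaths M := hasShortPaths_of_isRiemannianManifold (𝓡 d) M
  obtain ⟨ρ, hρ, hsec⟩ := exists_radius_forall_exists_section (EuclideanSpace ℝ (Fin d)) M M
  obtain ⟨b, hb, hbL⟩ := hreg.lower_bound
  have hLpos (w x) : 0 < L w x := hb.trans_le (hbL w x)
  have hint : Integrable (fun z : X × M => Real.log (L z.1 z.2)) μ := by
    obtain ⟨h1, h2⟩ := hreg.integrable_log μ hμ
    refine (h1.sub h2).congr (Eventually.of_forall fun z => ?_)
    exact Real.posLog_sub_posLog_inv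
  obtain ⟨c, hc, htimes⟩ := hexp.ae_exists_minimal_times hμ.invariant hint
  obtain ⟨δ, hδ, hdist⟩ := hreg.distortion c hc
  obtain ⟨_, -, _, -, -, hunif⟩ := hgen.uniform_along_orbits
  have hbase {Φ : X → Prop} (h : ∀ᵐ w ∂P, Φ w) : ∀ᵐ z ∂μ, Φ z.1 := by
    rw [← hμ.marginal] at h
    exact ae_of_ae_map measurable_fst.aemeasurable h
  have horbit : ∀ᵐ w ∂P, ∀ j, ∀ x, ∀ z ∈ Metric.ball x δ,
      L (θ^[j] w) x / L (θ^[j] w) z ≤ Real.exp (c / 2) :=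
    ae_all_iff.2 fun j =>
      (hsys.ergodic_base.toMeasurePreserving.iterate j).quasiMeasurePreserving.ae hdist
  have key : ∀ᵐ z ∂μ, ∀ ε : ℝ, 0 < ε → ∃ K : ℕ → ℕ,
      (∀ n : ℕ, 1 ≤ n → ∃ p ∈ RandomSpec.dynamicalBall θ f n z.1 z.2 ε,
        RandomSpec.ReturnsAt θ f z.1 p (n + K n)) ∧
      limsup (fun n : ℕ => (((K n : ℝ) / (n : ℝ) : ℝ) : EReal)) atTop = 0 := by
    filter_upwards [htimes, hbase horbit, hbase hunif] with z hz hzdist hzunif ε hε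
    obtain ⟨Lhat, σhat, -, hbound, -⟩ := hzunif
    -- Off the region `A` the constant `L` is below `σ⁻¹ < 1`.
    have hLΛ (j : ℕ) (x : M) : L (θ^[j] z.1) x ≤ max Lhat 1 := by
      by_cases hx : x ∈ A (θ^[j] z.1)
      · exact (hgen.lip_on_region _ x hx).trans ((hbound j).1.trans (le_max_left _ _))
      · exact (hgen.lip_off_region _ x hx).le.trans
          ((inv_le_one_of_one_le₀ (hgen.one_lt_rate _).le).trans (le_max_right _ _))
    obtain ⟨m₀, N, hN, hper⟩ := RandomSpec.exists_periodic_of_isMinimal_times hM (x := z.2) hρ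
      (fun w a => hsec (f w) (hsys.isLocalHomeomorph w) a)
      (fun w x => by
        obtain ⟨U, hU, -, h⟩ := hsys.local_inverse_lip w x
        exact ⟨U, hU, h⟩)
      hLpos (le_max_right _ _) hLΛ hc hδ
      (fun j a y hy => by
        have := hzdist j y a (by rwa [Metric.mem_ball, dist_comm])
        rwa [div_le_iff₀ (hLpos _ _)] at this)
      (fun e he => by
        obtain ⟨N, hN, h⟩ := hgen.topologically_exact z.1 e he
        exact ⟨N, hN, fun j => h j z.2⟩)
      hε
    -- The threshold `m₀` depends on `ε` and on the point, so the times are chosen after it. The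
    -- natural subtraction below is exact because `n ≤ τ n`.
    obtain ⟨τ, hτ, hlim⟩ := hz m₀
    refine ⟨fun n => τ n + N - n, fun n hn => ?_,
      RandomSpec.limsup_return_gap_eq_zero (fun n => (hτ n).1) N hlim⟩
    obtain ⟨h1, h2, h3⟩ := hτ n
    obtain ⟨p, hp, hfix⟩ := hper (τ n) h2 h3
    refine ⟨p, RandomSpec.dynamicalBall_subset h1 le_rfl hp, by omega, ?_⟩
    rwa [show n + (τ n + N - n) = τ n + N by omega]
  -- A single choice per `(z, ε)` gives the whole sequence; the value `0` occurs only where no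
  -- sequence exists, and `key` rules this out almost everywhere for `ε > 0`.
  refine ⟨fun n z ε => if h : ∃ K : ℕ → ℕ,
      (∀ n : ℕ, 1 ≤ n → ∃ p ∈ RandomSpec.dynamicalBall θ f n z.1 z.2 ε,
        RandomSpec.ReturnsAt θ f z.1 p (n + K n)) ∧
      limsup (fun n : ℕ => (((K n : ℝ) / (n : ℝ) : ℝ) : EReal)) atTop = 0
    then h.choose n else 0, ?_⟩
  filter_upwards [key] with z hz ε hε
  have h := hz ε hε
  simp only [dif_pos h]
  exact h.choose_spec
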